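/- Let $p$ be a prime. A valued field $(K,\nu)$ of mixed characteristic $(0,p)$ is $\mathbb Z$-valued if its value group is isomorphic to $\mathbb Z$; its initial ramification index is $e=|(0,\nu(p)]|$, where the interval is taken in the value group (for a $\mathbb Z$-valued field of mixed characteristic it is always finite, i.e. the field is finitely ramified). Write $\mathcal O_\nu$, $\mathfrak m_\nu$, $K\nu$ for the valuation ring, its maximal ideal and the residue field. For $n\ge 1$ the $n$th valued hyperfield of $(K,\nu)$ is $\mathcal H_{\nu,n}=K/(1+\mathfrak m_\nu^n)$, with classes $[a]_n=a(1+\mathfrak m_\nu^n)$, multiplication $[a]_n[b]_n=[ab]_n$, multivalued addition $[a]_n+[b]_n=\{[x+y]_n: x\in[a]_n,\ y\in[b]_n\}$, and valuation $\nu_{\mathcal H}([a]_n)=\nu(a)$. An embedding $f:\mathcal H_{\nu,n}\to\mathcal H_{\omega,n}$ is an injective map with $f(0)=0$, $f(1)=1$, $f(\alpha\beta)=f(\alpha)f(\beta)$, $f(\alpha+\beta)\subseteq f(\alpha)+f(\beta)$, and $\nu_{\mathcal H}(\alpha)\le\nu_{\mathcal H}(\beta)\Leftrightarrow\omega_{\mathcal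 H}(f(\alpha))\le\omega_{\mathcal H}(f(\beta))$. An embedding $\Phi:(K,\nu)\to(L,\omega)$ of valued fields is a field embedding with $\nu(x)\le\nu(y)\Leftrightarrow\omega(\Phi(x))\le\omega(\Phi(y))$; it induces the map $[a]_n\mapsto[\Phi(a)]_n$ from $\mathcal H_{\nu,n}$ to $\mathcal H_{\omega,n}$. A strict Cohen subring of $\mathcal O_\nu$ is a complete discrete valuation ring $R\subseteq\mathcal O_\nu$ with uniformizer $p$ and with the same residue field as $\mathcal O_\nu$. For such an $R$ and a uniformizer $\pi$ of $K$ with minimal (Eisenstein) polynomial $P$ over $R$, when $e\ge 2$, put $$M_\nu=\max\{\nu(\pi-\pi'):\ \pi'\in K^{alg},\ P(\pi')=0,\ \pi'\ne\pi\},$$ where $\nu$ is extended to $K^{alg}$ and normalized by $\nu(p)=1$. **Lemma.** Let $(K_0,\nu_0)$, $(K,\nu)$ and $(L,\omega)$ be complete finitely ramified $\mathbb Z$-valued fields of mixed characteristic $(0,p)$ with the same initial ramification index $e$, such that $K_0$ is a valued subfield of $K$ and the (not necessarily algebraic) extension $K\nu/K_0\nu_0$ is separable, i.e. elements of $K_0\nu_0$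 that are linearly independent over $(K_0\nu_0)^p$ are linearly independent over $(K\nu)^p$. Let $n$ be a positive integer; if $p\mid e$, assume moreover that $n>e^2M_\nu$, where $M_\nu$ is computed with some strict Cohen subring $R$ of $\mathcal O_\nu$ and some uniformizer $\pi$. Let $\Phi_0:(K_0,\nu_0)\to(L,\omega)$ be an embedding of valued fields, and let $\varphi_{\mathcal H}:\mathcal H_{\nu,n}\to\mathcal H_{\omega,n}$ be an embedding extending the map $\mathcal H_{\nu_0,n}\to\mathcal H_{\omega,n}$ induced by $\Phi_0$, i.e. $\varphi_{\mathcal H}([a]_n)=[\Phi_0(a)]_n$ for all $a\in K_0$. Then there is an embedding of valued fields $\Phi:(K,\nu)\to(L,\omega)$ extending $\Phi_0$. Moreover, if $p\nmid e$, then $\Phi$ can be chosen so that in addition it induces $\varphi_{\mathcal H}$, i.e. $\varphi_{\mathcal H}([a]_n)=[\Phi(a)]_n$ for all $a\in K$. -/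

import Mathlib

open scoped WithZero

namespace FinRam

open IsLocalRing

universe u₁ u₂

/-! Valuations are written multiplicatively: a `ℤ`-valued field is a field with a surjective
`Valuation` to `ℤᵐ⁰`. The additive valuation is `ν x = -log (v x)`, so `v x ≤ v y` means
`ν y ≤ ν x`. -/

section Fields

variable {K : Type u₁} [Field K] {L : Type u₂} [Field L]

/-- `(K, v)` is a complete finitely ramified `ℤ`-valued field of mixed characteristic `(0, p)` with
initial ramification index `e`. As `v` is onto `ℤᵐ⁰`, `Set.Ico (v p) 1` is the interval `(0, ν(p)]`
of the value group. -/
structure IsCompleteFinRamified (v : Valuation K ℤᵐ⁰) (p e : ℕ) : Prop where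
  prime : p.Prime
  charZero : CharZero K
  residueChar : CharP (ResidueField v.valuationSubring) p
  surjective : Function.Surjective v
  /-- completeness for the uniform structure defined by the valuation -/
  complete : @CompleteSpace K (Valued.mk' v).toUniformSpace
  finite : (Set.Ico (v (p : K)) 1).Finite
  index : (Set.Ico (v (p : K)) 1).ncard = e

/-- Embeddings of valued fields: ring homomorphisms `Φ` with
`v x ≤ v y ↔ w (Φ x) ≤ w (Φ y)` for all `x, y`. -/
structure ValuedEmb (v : Valuation K ℤᵐ⁰) (w : Valuation L ℤᵐ⁰) extends K →+* L where
  isEquiv : v.IsEquiv (w.comap toRingHom)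

/-- The inclusion of a valued subfield `(K, v)` of `(L, w)`. -/
def inclusion (v : Valuation K ℤᵐ⁰) (w : Valuation L ℤᵐ⁰) [Algebra K L] [v.HasExtension w] :
    ValuedEmb v w :=
  ⟨algebraMap K L, Valuation.HasExtension.val_isEquiv_comap⟩

/-- The ring homomorphism between valuation rings given by an embedding of valued fields. -/
def ValuedEmb.integerMap {v : Valuation K ℤᵐ⁰} {w : Valuation L ℤᵐ⁰} (Φ : ValuedEmb v w) :
    v.valuationSubring →+* w.valuationSubring :=
  Φ.toRingHom.restrict v.valuationSubring w.valuationSubring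
    (fun _ hx => Φ.isEquiv.le_one_iff_le_one.mp hx)

/-- A (not necessarily algebraic) extension `k / k₀` of fields of characteristic `p` is separable if
`k₀` and `k ^ p` are linearly disjoint over `k₀ ^ p`: elements of `k₀` which are linearly
independent over `k₀ ^ p` stay linearly independent over `k ^ p`. -/
def IsSeparableExt (p : ℕ) (k₀ : Type u₁) (k : Type u₂) [Field k₀] [Field k] [Algebra k₀ k] :
    Prop :=
  ∀ (m : ℕ) (a : Fin m → k₀),
    (∀ c : Fin m → k₀, ∑ i, a i * c i ^ p = 0 → c = 0) →
      ∀ b : Fin m → k, ∑ i, algebraMap k₀ k (a i) * b i ^ p = 0 → b = 0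

/-! ### The invariant `M` -/

/-- `R` is a strict Cohen subring of the valuation ring `𝒪` of `v`: a complete discrete valuation
ring `R ⊆ 𝒪` with uniformizer `p`, over which `𝒪` is totally ramified (`R` and `𝒪` have the same
residue field). -/
structure IsStrictCohenSubring (v : Valuation K ℤᵐ⁰) (p : ℕ) (R : Subring K) : Prop where
  le : R ≤ v.valuationSubring.toSubring
  dvr : IsDiscreteValuationRing R
  unramified : Irreducible (p : R)
  complete : IsAdicComplete (Ideal.span {(p : R)}) R
  residue : ∀ x : K, v x ≤ 1 → ∃ r ∈ R, v (x - r) < 1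

/-- `μ` is the (additive, real valued) extension of `v` to the algebraic closure, normalized by
`μ p = 1`. -/
def IsNormalizedExtension (v : Valuation K ℤᵐ⁰) (p : ℕ)
    (μ : AddValuation (AlgebraicClosure K) (WithTop ℝ)) : Prop :=
  μ (p : AlgebraicClosure K) = 1 ∧
    ∀ x y : K, v x ≤ v y ↔
      μ (algebraMap K (AlgebraicClosure K) y) ≤ μ (algebraMap K (AlgebraicClosure K) x)

/-- `M = max {μ (π - π') : π' a root of P, π' ≠ π}`, where `π` is a uniformizer of `v`, `P` is its
minimal (Eisenstein) polynomial over the strict Cohen subring `R`, and `μ` is the normalized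
extension of `v` to the algebraic closure. -/
def IsMInvariant (v : Valuation K ℤᵐ⁰) (p : ℕ) (R : Subring K) (M : ℝ) : Prop :=
  ∃ (π : K) (μ : AddValuation (AlgebraicClosure K) (WithTop ℝ)),
    v π = WithZero.exp (-1) ∧ IsNormalizedExtension v p μ ∧
    IsGreatest {m : ℝ | ∃ π' : AlgebraicClosure K,
      Polynomial.aeval π' (minpoly R π) = 0 ∧
      π' ≠ algebraMap K (AlgebraicClosure K) π ∧
      μ (algebraMap K (AlgebraicClosure K) π - π') = (m : WithTop ℝ)} M

end Fields

/-! ### Higher valued hyperfields -/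

section Hyperfields

variable {K : Type u₁} [Field K] {L : Type u₂} [Field L]

/-- Two elements are identified if they differ by a factor in `1 + 𝔪 ^ n`. (For `n ≥ 1` all elements
of `1 + 𝔪 ^ n` are units of the valuation ring, see `mk_eq_mk_iff`.) -/
def hyperSetoid (v : Valuation K ℤᵐ⁰) (n : ℕ) : Setoid K where
  r a b := ∃ u : v.valuationSubringˣ,
    (u : v.valuationSubring) - 1 ∈ maximalIdeal v.valuationSubring ^ n ∧
      b = a * ((u : v.valuationSubring) : K)
  iseqv :=
    { refl := fun a => ⟨1, by simp, by simp⟩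
      symm := by
        rintro a b ⟨u, hu, rfl⟩
        refine ⟨u⁻¹, ?_, ?_⟩
        · have h : ((u⁻¹ : v.valuationSubringˣ) : v.valuationSubring) - 1 =
              (-((u⁻¹ : v.valuationSubringˣ) : v.valuationSubring)) *
                ((u : v.valuationSubring) - 1) := by
            rw [mul_sub, neg_mul, Units.inv_mul]; ring
          rw [h]
          exact Ideal.mul_mem_left _ _ hu
        · have h : ((u : v.valuationSubring) : K) *
              (((u⁻¹ : v.valuationSubringˣ) : v.valuationSubring) : K) = 1 := by
            exact_mod_cast congrArg (fun x : v.valuationSubring => (x : K)) u.mul_inv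
          rw [mul_assoc, h, mul_one]
      trans := by
        rintro a b c ⟨u, hu, rfl⟩ ⟨t, ht, rfl⟩
        refine ⟨u * t, ?_, by push_cast; ring⟩
        have h : ((u * t : v.valuationSubringˣ) : v.valuationSubring) - 1 =
            (t : v.valuationSubring) * ((u : v.valuationSubring) - 1) +
              ((t : v.valuationSubring) - 1) := by
          push_cast; ring
        rw [h]
        exact Ideal.add_mem _ (Ideal.mul_mem_left _ _ hu) ht }

/-- The underlying set `K / (1 + 𝔪 ^ n)` of the `n`th valued hyperfield of `(K, v)`. -/
def Hyper (v : Valuation K ℤᵐ⁰) (n : ℕ) : Type u₁ := Quotient (hyperSetoid v n)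

namespace Hyper

variable {v : Valuation K ℤᵐ⁰} {w : Valuation L ℤᵐ⁰} {n : ℕ}

/-- The class `[a]` of `a`. -/
def mk (v : Valuation K ℤᵐ⁰) (n : ℕ) (a : K) : Hyper v n := Quotient.mk (hyperSetoid v n) a

theorem mk_eq_mk_iff (hn : 0 < n) (a b : K) :
    mk v n a = mk v n b ↔
      ∃ x ∈ maximalIdeal v.valuationSubring ^ n, b = a * (1 + (x : K)) := by
  refine Quotient.eq.trans ⟨?_, ?_⟩
  · rintro ⟨u, hu, rfl⟩
    exact ⟨_, hu, by push_cast; ring⟩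
  · rintro ⟨x, hx, rfl⟩
    have hx' : x ∈ maximalIdeal v.valuationSubring := Ideal.pow_le_self hn.ne' hx
    have hunit : IsUnit (1 + x) := by
      by_contra h
      have h1 : (1 + x) ∈ maximalIdeal v.valuationSubring := (mem_maximalIdeal _).2 h
      have h2 : (1 : v.valuationSubring) ∈ maximalIdeal v.valuationSubring := by
        simpa using Ideal.sub_mem _ h1 hx'
      exact (Ideal.ne_top_iff_one _).1 (maximalIdeal.isMaximal _).ne_top h2
    exact ⟨hunit.unit, by simpa using hx, by simp⟩

instance : Zero (Hyper v n) := ⟨mk v n 0⟩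

instance : One (Hyper v n) := ⟨mk v n 1⟩

/-- The multiplication `[a] * [b] = [a * b]`. -/
instance : Mul (Hyper v n) :=
  ⟨Quotient.map₂ (· * ·) (by
    rintro a a' ⟨u, hu, rfl⟩ b b' ⟨t, ht, rfl⟩
    have h1 := (hyperSetoid v n).iseqv.trans (x := a * b)
      (y := a * b * ((u : v.valuationSubring) : K))
      (z := a * b * ((u : v.valuationSubring) : K) * ((t : v.valuationSubring) : K))
      ⟨u, hu, rfl⟩ ⟨t, ht, rfl⟩
    have h2 : a * ((u : v.valuationSubring) : K) * (b * ((t : v.valuationSubring) : K)) =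
        a * b * ((u : v.valuationSubring) : K) * ((t : v.valuationSubring) : K) := by ring
    change (hyperSetoid v n).r _ _
    rw [h2]
    exact h1)⟩

/-- The multivalued addition `α + β = {[x + y] : x ∈ α, y ∈ β}`. -/
def hadd (α β : Hyper v n) : Set (Hyper v n) :=
  {γ | ∃ x y : K, mk v n x = α ∧ mk v n y = β ∧ mk v n (x + y) = γ}

/-- The valuation `[a] ↦ v a`. -/
def val (α : Hyper v n) : ℤᵐ⁰ :=
  Quotient.lift v (by
    rintro a b ⟨u, -, rfl⟩
    have h : v ((u : v.valuationSubring) : K) = 1 := by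
      have h1 : v ((u : v.valuationSubring) : K) ≤ 1 := (u : v.valuationSubring).2
      have h2 : v (((u⁻¹ : v.valuationSubringˣ) : v.valuationSubring) : K) ≤ 1 :=
        ((u⁻¹ : v.valuationSubringˣ) : v.valuationSubring).2
      have h3 : v ((u : v.valuationSubring) : K) *
          v (((u⁻¹ : v.valuationSubringˣ) : v.valuationSubring) : K) = 1 := by
        rw [← map_mul, ← map_one v]
        exact congrArg v (congrArg (fun x : v.valuationSubring => (x : K)) u.mul_inv)
      refine le_antisymm h1 ?_
      calc (1 : ℤᵐ⁰) = _ := h3.symm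
        _ ≤ v ((u : v.valuationSubring) : K) * 1 := mul_le_mul_right h2 _
        _ = _ := mul_one _
    rw [map_mul, h, mul_one]) α

/-- The map `[a] ↦ [Φ a]` of `n`th valued hyperfields induced by an embedding `Φ` of valued
fields. -/
def induced (n : ℕ) (Φ : ValuedEmb v w) : Hyper v n → Hyper w n :=
  Quotient.map' (s₁ := hyperSetoid v n) (s₂ := hyperSetoid w n) Φ.toRingHom (by
    rintro a b ⟨u, hu, rfl⟩
    refine ⟨Units.map Φ.integerMap.toMonoidHom u, ?_, ?_⟩
    · have hle : (maximalIdeal v.valuationSubring).map Φ.integerMap ≤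
          maximalIdeal w.valuationSubring := by
        rw [Ideal.map_le_iff_le_comap]
        intro x hx
        have hx1 : v (x : K) < 1 := (Valuation.mem_maximalIdeal_iff _ _).1 hx
        exact (Valuation.mem_maximalIdeal_iff _ _).2 (Φ.isEquiv.lt_one_iff_lt_one.mp hx1)
      have h1 := Ideal.mem_map_of_mem Φ.integerMap hu
      rw [Ideal.map_pow] at h1
      have h2 := Ideal.pow_right_mono hle n h1
      simpa using h2
    · rw [map_mul]
      rfl)

@[simp] theorem induced_mk (Φ : ValuedEmb v w) (a : K) :
    induced n Φ (mk v n a) = mk w n (Φ.toRingHom a) := rfl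

end Hyper

/-- Embeddings of `n`th valued hyperfields: injective homomorphisms. -/
structure HyperEmb (v : Valuation K ℤᵐ⁰) (w : Valuation L ℤᵐ⁰) (n : ℕ) where
  toFun : Hyper v n → Hyper w n
  injective : Function.Injective toFun
  map_zero : toFun 0 = 0
  map_one : toFun 1 = 1
  map_mul : ∀ α β, toFun (α * β) = toFun α * toFun β
  map_hadd : ∀ α β, toFun '' Hyper.hadd α β ⊆ Hyper.hadd (toFun α) (toFun β)
  val_le_iff : ∀ α β : Hyper v n,
    Hyper.val α ≤ Hyper.val β ↔ Hyper.val (toFun α) ≤ Hyper.val (toFun β)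

end Hyperfields

end FinRam

/-! Equal ramification indices make a uniformizer `π` of `K₀` a uniformizer of `K` and of `L` too.
So the valuation ring of `K` is torsion-free over that of `K₀`, its reduction modulo `π` is the
residue field, and separability makes this extension formally smooth for the adic topology. The
hyperfield embedding amounts, on integers, to a ring homomorphism into the valuation ring of `L`
modulo `𝔪 ^ n` (`HyperEmb.exists_ringHom`). It lifts step by step modulo `𝔪 ^ (n + m)`, hence to the
complete ring (`exists_adic_lift_of_isSeparableExt`), and extends to fraction fields. The result
induces `φ` since every nonzero element is a power of `π`, where `φ` is prescribed, times a unit,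
whose class depends only on its residue modulo `𝔪 ^ n`. One `Φ` gives both conclusions.

Each lifting step is a section problem: a square-zero extension of the residue field `k` must split
over `k₀` (`exists_section_of_isSeparableExt`). -/

namespace FinRam

/-! ### Splitting square-zero extensions of a separable field extension -/

section SquareZeroSection

open Polynomial

variable {k₀ k A : Type*} [Field k₀] [Field k] [CommRing A] [Algebra k₀ k] [Algebra k₀ A]

/-- Subtracting a multiple of a relation over `p`-th powers does not change a `p`-polynomial. -/
theorem sum_smul_sub_pow {p m : ℕ} [Fact p.Prime] [CharP A p] (c d : Fin m → k₀)
    (hd : ∑ j, c j * d j ^ p = 0) (a : Fin m → A) (b : A) :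
    ∑ j, c j • (a j - d j • b) ^ p = ∑ j, c j • a j ^ p := by
  have h : ∑ j, c j • (d j • b) ^ p = 0 := by
    simp_rw [_root_.smul_pow, smul_smul, ← Finset.sum_smul, hd, zero_smul]
  simp_rw [sub_pow_char, smul_sub, Finset.sum_sub_distrib, h, sub_zero]

/-- If the `c j` are independent over `p`-th powers, separability puts every `a j` in the kernel,
where `p`-th powers vanish because `p ≥ 2`. Otherwise a relation among the `c j` removes one term,
and induction on `m` applies. -/
theorem sum_smul_pow_eq_zero {p : ℕ} [Fact p.Prime] [CharP k p] [CharP A p]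
    (hsep : IsSeparableExt p k₀ k) (q : A →ₐ[k₀] k)
    (hsq : ∀ x y, q x = 0 → q y = 0 → x * y = 0) :
    ∀ (m : ℕ) (c : Fin m → k₀) (a : Fin m → A), ∑ j, c j • q (a j) ^ p = 0 →
      ∑ j, c j • a j ^ p = 0 := by
  have hp : p.Prime := Fact.out
  intro m
  induction m with
  | zero => simp
  | succ m ih =>
    intro c a h
    by_cases hc : ∀ d : Fin (m + 1) → k₀, ∑ i, c i * d i ^ p = 0 → d = 0
    · have h0 := hsep _ c hc (fun j => q (a j)) (by simpa [Algebra.smul_def] using h)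
      refine Finset.sum_eq_zero fun j _ => ?_
      have hj : q (a j) = 0 := congrFun h0 j
      obtain ⟨r, hr⟩ := Nat.exists_eq_add_of_le hp.two_le
      rw [hr, pow_add, pow_two, hsq _ _ hj hj, zero_mul, smul_zero]
    · push Not at hc
      obtain ⟨d, hd, hd0⟩ := hc
      obtain ⟨i, hi⟩ := Function.ne_iff.1 hd0
      have hi : d i ≠ 0 := hi
      -- With the coefficient at `i` scaled to `1`, subtracting `(d j / d i) • a i` from each `a j`
      -- kills the `i`-th term in `A` and in `k` alike.
      have hd' : ∑ j, c j * (d j / d i) ^ p = 0 := by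
        simp_rw [div_pow, mul_div_assoc', ← Finset.sum_div, hd, zero_div]
      have hA := sum_smul_sub_pow c _ hd' a (a i)
      have hk := sum_smul_sub_pow c _ hd' (fun j => q (a j)) (q (a i))
      rw [← hA, Fin.sum_univ_succAbove _ i]
      rw [h, Fin.sum_univ_succAbove _ i] at hk
      simp only [div_self hi, one_smul, sub_self, zero_pow hp.ne_zero, smul_zero, zero_add] at hk ⊢
      exact ih _ _ (by simpa using hk)

/-- The subalgebra generated by the `p`-th powers meets the kernel of `q` trivially. -/
theorem eq_zero_of_mem_adjoin_pow {p : ℕ} [Fact p.Prime] [CharP k p] [CharP A p]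
    (hsep : IsSeparableExt p k₀ k) (q : A →ₐ[k₀] k)
    (hsq : ∀ x y, q x = 0 → q y = 0 → x * y = 0) {b : A}
    (hb : b ∈ Algebra.adjoin k₀ (Set.range fun a : A => a ^ p)) (hqb : q b = 0) : b = 0 := by
  -- The `p`-th powers form a submonoid, so the algebra they generate is just their linear span.
  have h1 : (Set.range fun a : A => a ^ p) = (MonoidHom.mrange (powMonoidHom (α := A) p) : Set A) :=
    by ext; simp
  rw [← Subalgebra.mem_toSubmodule, h1, Algebra.adjoin_eq_span, Submonoid.closure_eq, ← h1,
    Submodule.mem_span_set'] at hb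
  obtain ⟨m, c, g, rfl⟩ := hb
  choose a ha using fun i => (g i).2
  simp only [← ha] at hqb ⊢
  exact sum_smul_pow_eq_zero hsep q hsq m c a (by simpa using hqb)

/-- If `a ^ p` lies in `B` and the image of `a` in the field `k` does not, then the kernel of
`A → k` meets `B[a]` trivially. -/
theorem eq_zero_of_mem_adjoin_singleton {B : Type*} [CommRing B] (hB : IsField B) [Algebra B k]
    [Algebra B A] {p : ℕ} [Fact p.Prime] [CharP k p] (q : A →ₐ[B] k) (a : A) (β : B) (ha : a ^ p = algebraMap B A β)
    (hx : ∀ b : B, algebraMap B k b ≠ q a) {b : A} (hb : b ∈ Algebra.adjoin B {a})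
    (hqb : q b = 0) : b = 0 := by
  have hp : p.Prime := Fact.out
  let _ : Field B := hB.toField
  have hqa : q a ^ p = algebraMap B k β := by rw [← map_pow, ha, AlgHom.commutes]
  -- A `p`-th root of `β` in `B` would map to `q a`, by injectivity of Frobenius on `k`.
  have hirr : Irreducible (X ^ p - C β) := by
    refine X_pow_sub_C_irreducible_of_prime hp fun b hb => hx b ?_
    apply frobenius_inj k p
    simp only [frobenius_def]
    rw [← map_pow, hb, hqa]
  have hmin : X ^ p - C β = minpoly B (q a) :=
    minpoly.eq_of_irreducible_of_monic hirr (by simp [hqa]) (monic_X_pow_sub_C _ hp.ne_zero)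
  rw [Algebra.adjoin_singleton_eq_range_aeval] at hb
  obtain ⟨f, rfl⟩ := hb
  have hf : aeval (q a) f = 0 := by
    rw [← hqb]
    exact aeval_algHom_apply q a f
  obtain ⟨g, rfl⟩ := hmin ▸ minpoly.dvd B (q a) hf
  simp [ha]

/-- By Zorn, take a maximal subalgebra that contains all `p`-th powers and meets the kernel
trivially. It maps isomorphically onto `k`, and the inverse is the section. -/
theorem exists_section_of_isSeparableExt {p : ℕ} [Fact p.Prime] [CharP k p] [CharP A p]
    (hsep : IsSeparableExt p k₀ k) (q : A →ₐ[k₀] k) (hq : Function.Surjective q)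
    (hsq : ∀ x y, q x = 0 → q y = 0 → x * y = 0) :
    ∃ s : k →ₐ[k₀] A, ∀ x, q (s x) = x := by
  have hp : p.Prime := Fact.out
  let P : Set (Subalgebra k₀ A) := {B | (∀ a : A, a ^ p ∈ B) ∧ ∀ b ∈ B, q b = 0 → b = 0}
  obtain ⟨B, -, ⟨hBp, hB0⟩, hmax⟩ := zorn_le_nonempty₀ P (by
    intro c hcP hc y hy
    refine ⟨sSup c, ⟨fun a => (le_sSup hy : y ≤ sSup c) ((hcP hy).1 a), fun b hb hqb => ?_⟩,
      fun z hz => le_sSup hz⟩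
    have : Nonempty c := ⟨⟨y, hy⟩⟩
    rw [← SetLike.mem_coe, sSup_eq_iSup',
      Subalgebra.coe_iSup_of_directed (directedOn_iff_directed.1 hc.directedOn)] at hb
    simp only [Set.mem_iUnion] at hb
    obtain ⟨⟨z, hz⟩, hbz⟩ := hb
    exact (hcP hz).2 b hbz hqb) _
    (show Algebra.adjoin k₀ (Set.range fun a : A => a ^ p) ∈ P from
      ⟨fun a => Algebra.subset_adjoin ⟨a, rfl⟩,
        fun b hb hqb => eq_zero_of_mem_adjoin_pow hsep q hsq hb hqb⟩)
  have hinj : Function.Injective (q.comp B.val) := by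
    rw [injective_iff_map_eq_zero]
    exact fun b hb => Subtype.ext (hB0 _ b.2 hb)
  have hfield : IsField B :=
    { exists_pair_ne := ⟨0, 1, fun h => zero_ne_one (α := k) (by simpa using congrArg (q.comp B.val) h)⟩
      mul_comm := mul_comm
      mul_inv_cancel := by
        intro b hb
        have hqb : q b ≠ 0 := fun h => hb (Subtype.ext (hB0 _ b.2 h))
        obtain ⟨y, hy⟩ := hq (q b)⁻¹
        -- An inverse of `b` need not visibly lie in `B`, but the `p`-th power of a lift `y` of `(q
        -- b)⁻¹` does.
        refine ⟨b ^ (p - 1) * ⟨y ^ p, hBp y⟩, hinj ?_⟩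
        simp only [AlgHom.comp_apply, map_mul, map_pow, map_one, Subalgebra.coe_val, hy]
        rw [← mul_assoc, ← pow_succ', Nat.sub_add_cancel hp.one_le, ← mul_pow,
          mul_inv_cancel₀ hqb, one_pow] }
  have hsurj : Function.Surjective (q.comp B.val) := by
    intro x
    by_contra! hx
    obtain ⟨a, rfl⟩ := hq x
    let _ : Algebra B k := (q.comp B.val).toRingHom.toAlgebra
    let qB : A →ₐ[B] k := { q with commutes' := fun b => rfl }
    have hmem : (Algebra.adjoin B {a}).restrictScalars k₀ ∈ P :=
      ⟨fun y => (Algebra.adjoin B {a}).algebraMap_mem ⟨y ^ p, hBp y⟩, fun b hb hqb =>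
        eq_zero_of_mem_adjoin_singleton hfield qB a ⟨a ^ p, hBp a⟩ rfl hx hb hqb⟩
    have hle : B ≤ (Algebra.adjoin B {a}).restrictScalars k₀ := fun b hb =>
      (Algebra.adjoin B {a}).algebraMap_mem ⟨b, hb⟩
    have ha : a ∈ (Algebra.adjoin B {a}).restrictScalars k₀ :=
      Algebra.self_mem_adjoin_singleton B a
    have haB : a ∈ B := hmax hmem hle ha
    exact hx ⟨a, haB⟩ rfl
  let eqv := AlgEquiv.ofBijective (q.comp B.val) ⟨hinj, hsurj⟩
  exact ⟨B.val.comp eqv.symm.toAlgHom, fun x => eqv.apply_symm_apply x⟩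

end SquareZeroSection


/-! ### Lifting homomorphisms along nilpotent and adic thickenings -/

section Lifting

open IsLocalRing

/-- Let `S / R` be an extension of local rings with principal maximal ideals generated by the same
element `π`, a nonzerodivisor of `S`, and with separable residue field extension. Then ring
homomorphisms over `R` lift along surjections `g` whose kernel has square zero and is killed
by `π`. -/
theorem exists_lift_of_isSeparableExt {R S T T' : Type*} [CommRing R] [CommRing S] [CommRing T]
    [CommRing T'] [IsLocalRing R] [IsLocalRing S] [Algebra R S]
    [Algebra (ResidueField R) (ResidueField S)]
    (hres : ∀ r : R, algebraMap (ResidueField R) (ResidueField S) (residue R r) =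
      residue S (algebraMap R S r))
    {p : ℕ} [Fact p.Prime] [CharP (ResidueField R) p]
    (hsep : IsSeparableExt p (ResidueField R) (ResidueField S))
    {π : R} (hR : maximalIdeal R = Ideal.span {π})
    (hS : maximalIdeal S = Ideal.span {algebraMap R S π})
    (hπ : ∀ z : S, algebraMap R S π * z = 0 → z = 0)
    (f : R →+* T) (g : T →+* T') (hg : Function.Surjective g)
    (hsq : ∀ s t, g s = 0 → g t = 0 → s * t = 0) (hker : ∀ t, g t = 0 → f π * t = 0)
    (ψ : S →+* T') (hψ : ∀ r, ψ (algebraMap R S r) = g (f r)) :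
    ∃ ψ' : S →+* T, (∀ r, ψ' (algebraMap R S r) = f r) ∧ ∀ x, g (ψ' x) = ψ x := by
  -- The fibre product of `S` and `T` over `T'`: lifts of `ψ` are sections of `E → S`. Modulo `π`
  -- this becomes the square-zero extension `A` of the residue field of `S`.
  let E : Subring (S × T) :=
    RingHom.eqLocus (ψ.comp (RingHom.fst S T)) (g.comp (RingHom.snd S T))
  have hE : ∀ y : E, ψ y.1.1 = g y.1.2 := fun y => y.2
  let ι : R →+* E := ((algebraMap R S).prod f).codRestrict E hψ
  let A := E ⧸ Ideal.span {ι π}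
  let i : ResidueField R →+* A := Ideal.Quotient.lift (maximalIdeal R)
    ((Ideal.Quotient.mk (Ideal.span {ι π})).comp ι) (by
      intro r hr
      rw [hR, Ideal.mem_span_singleton] at hr
      exact Ideal.Quotient.eq_zero_iff_dvd _ _ |>.2 (map_dvd ι hr))
  have hi : ∀ r, i (residue R r) = Ideal.Quotient.mk (Ideal.span {ι π}) (ι r) := fun r =>
    Ideal.Quotient.lift_mk _ _ _
  let q₀ : A →+* ResidueField S := Ideal.Quotient.lift (Ideal.span {ι π})
    ((residue S).comp ((RingHom.fst S T).comp E.subtype)) (by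
      intro y hy
      obtain ⟨z, rfl⟩ := Ideal.mem_span_singleton.1 hy
      refine (residue_eq_zero_iff _).2 ?_
      rw [hS, Ideal.mem_span_singleton]
      exact ⟨z.1.1, rfl⟩)
  have hq₀ : ∀ y : E, q₀ (Ideal.Quotient.mk _ y) = residue S y.1.1 := fun y =>
    Ideal.Quotient.lift_mk _ _ _
  have hlift : ∀ x : S, ∃ y : E, y.1.1 = x := fun x => by
    obtain ⟨t, ht⟩ := hg (ψ x)
    exact ⟨⟨(x, t), ht.symm⟩, rfl⟩
  let _ : Algebra (ResidueField R) A := i.toAlgebra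
  let q : A →ₐ[ResidueField R] ResidueField S :=
    { q₀ with
      commutes' := by
        intro r
        obtain ⟨r, rfl⟩ := residue_surjective r
        exact (congrArg q₀ (hi r)).trans ((hq₀ _).trans (hres r).symm) }
  have hq : Function.Surjective q := by
    intro x
    obtain ⟨x, rfl⟩ := residue_surjective x
    obtain ⟨y, rfl⟩ := hlift x
    exact ⟨_, hq₀ y⟩
  have hred : ∀ a : A, q a = 0 → ∃ t, ∃ h : g t = 0, a =
      Ideal.Quotient.mk _ (⟨(0, t), (map_zero ψ).trans h.symm⟩ : E) := by
    intro a ha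
    obtain ⟨y, rfl⟩ := Ideal.Quotient.mk_surjective a
    have hy := (residue_eq_zero_iff _).1 ((hq₀ y).symm.trans ha)
    rw [hS, Ideal.mem_span_singleton] at hy
    obtain ⟨z, hz⟩ := hy
    obtain ⟨u, rfl⟩ := hlift z
    -- The first coordinate of `y` is `π z`; subtracting `ι π * u`, with `u` over `z`, makes it zero
    -- without changing the class.
    refine ⟨y.1.2 - f π * u.1.2, ?_, ?_⟩
    · rw [map_sub, map_mul, ← hE, ← hE, ← hψ, ← map_mul, ← hz, sub_self]
    · refine Ideal.Quotient.eq.2 (Ideal.mem_span_singleton.2 ⟨u, Subtype.ext (Prod.ext ?_ ?_)⟩)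
      · exact (sub_zero _).trans hz
      · exact sub_sub_cancel _ _
  have hsqA : ∀ a b, q a = 0 → q b = 0 → a * b = 0 := by
    intro a b ha hb
    obtain ⟨s, hs, rfl⟩ := hred a ha
    obtain ⟨t, ht, rfl⟩ := hred b hb
    rw [← map_mul]
    refine (congrArg _ ?_).trans (map_zero (Ideal.Quotient.mk (Ideal.span {ι π})))
    exact Subtype.ext (Prod.ext (zero_mul _) (hsq s t hs ht))
  have : Nontrivial A := q₀.domain_nontrivial
  have : CharP A p := charP_of_injective_ringHom i.injective p
  have : CharP (ResidueField S) p :=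
    charP_of_injective_ringHom (algebraMap (ResidueField R) (ResidueField S)).injective p
  obtain ⟨s, hs⟩ := exists_section_of_isSeparableExt hsep q hq hsqA
  let σ : ResidueField S →+* E ⧸ Ideal.span {ι π} := s
  -- The graph of the lift: pairs in `E` whose class modulo `π` is the one chosen by the section.
  let P : S → T → Prop := fun x t => ∃ y : E, y.1 = (x, t) ∧
    Ideal.Quotient.mk (Ideal.span {ι π}) y = σ (residue S x)
  have hP : ∀ x, ∃ t, P x t := by
    intro x
    obtain ⟨y, hy⟩ := Ideal.Quotient.mk_surjective (σ (residue S x))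
    have hxy : residue S (x - y.1.1) = 0 := by
      rw [map_sub, ← hq₀ y, hy]
      exact sub_eq_zero.2 (hs _).symm
    rw [residue_eq_zero_iff, hS, Ideal.mem_span_singleton] at hxy
    obtain ⟨z, hz⟩ := hxy
    obtain ⟨u, rfl⟩ := hlift z
    refine ⟨y.1.2 + f π * u.1.2, y + ι π * u, Prod.ext ?_ rfl, ?_⟩
    · change y.1.1 + algebraMap R S π * u.1.1 = x
      rw [← hz, add_sub_cancel]
    · rw [← hy, map_add, add_eq_left]
      exact (Ideal.Quotient.eq_zero_iff_dvd _ _).2 (dvd_mul_right _ _)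
  -- Two such pairs differ by `ι π * z`. Cancelling `π` in `S` gives `z.1.1 = 0`, so `z.1.2` lies in
  -- the kernel of `g`, which `f π` kills. All ring laws for `F` follow from this uniqueness.
  have hPu : ∀ x t t', P x t → P x t' → t = t' := by
    rintro x t t' ⟨y, hy, hys⟩ ⟨y', hy', hys'⟩
    obtain ⟨z, hz⟩ := Ideal.mem_span_singleton.1 (Ideal.Quotient.eq.1 (hys.trans hys'.symm))
    have hz' : y.1 - y'.1 = (ι π).1 * z.1 := congrArg Subtype.val hz
    rw [hy, hy'] at hz'
    have h1 : x - x = algebraMap R S π * z.1.1 := congrArg Prod.fst hz'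
    have h2 : t - t' = f π * z.1.2 := congrArg Prod.snd hz'
    have h3 := hπ _ (h1.symm.trans (sub_self x))
    rw [hker _ (by rw [← hE, h3, map_zero])] at h2
    exact sub_eq_zero.1 h2
  choose F hF using hP
  let ψ' : S →+* T :=
    { toFun := F
      map_one' := hPu _ _ _ (hF 1) ⟨1, rfl, by simp⟩
      map_zero' := hPu _ _ _ (hF 0) ⟨0, rfl, by simp⟩
      map_mul' := by
        intro a b
        obtain ⟨y, hy, hys⟩ := hF a
        obtain ⟨z, hz, hzs⟩ := hF b
        exact hPu _ _ _ (hF _) ⟨y * z, by simp [hy, hz], by simp [hys, hzs]⟩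
      map_add' := by
        intro a b
        obtain ⟨y, hy, hys⟩ := hF a
        obtain ⟨z, hz, hzs⟩ := hF b
        exact hPu _ _ _ (hF _) ⟨y + z, by simp [hy, hz], by simp [hys, hzs]⟩ }
  refine ⟨ψ', fun r => hPu _ _ _ (hF _) ⟨ι r, rfl, ?_⟩, fun x => ?_⟩
  · rw [← hi, ← hres]
    exact (s.commutes (residue R r)).symm
  · obtain ⟨y, hy, -⟩ := hF x
    have := hE y
    rw [hy] at this
    exact this.symm

/-- Iterating `exists_lift_of_isSeparableExt` gives lifts to complete rings. -/
theorem exists_adic_lift_of_isSeparableExt {R S T : Type*} [CommRing R] [CommRing S] [CommRing T]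
    [IsLocalRing R] [IsLocalRing S] [Algebra R S]
    [Algebra (ResidueField R) (ResidueField S)]
    (hres : ∀ r : R, algebraMap (ResidueField R) (ResidueField S) (residue R r) =
      residue S (algebraMap R S r))
    {p : ℕ} [Fact p.Prime] [CharP (ResidueField R) p]
    (hsep : IsSeparableExt p (ResidueField R) (ResidueField S))
    {π : R} (hR : maximalIdeal R = Ideal.span {π})
    (hS : maximalIdeal S = Ideal.span {algebraMap R S π})
    (hπ : ∀ z : S, algebraMap R S π * z = 0 → z = 0)
    (I : Ideal T) [IsAdicComplete I T] (f : R →+* T) (hf : f π ∈ I) {n : ℕ} (hn : 0 < n)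
    (ψ : S →+* T ⧸ I ^ n) (hψ : ∀ r, ψ (algebraMap R S r) = Ideal.Quotient.mk _ (f r)) :
    ∃ Ψ : S →+* T, (∀ r, Ψ (algebraMap R S r) = f r) ∧
      ∀ x, Ideal.Quotient.mk (I ^ n) (Ψ x) = ψ x := by
  have step : ∀ m, ∀ χ : S →+* T ⧸ I ^ (n + m),
      (∀ r, χ (algebraMap R S r) = Ideal.Quotient.mk _ (f r)) →
      ∃ χ' : S →+* T ⧸ I ^ (n + (m + 1)),
        (∀ r, χ' (algebraMap R S r) = Ideal.Quotient.mk _ (f r)) ∧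
        ∀ x, Ideal.Quotient.factorPow I (n + m).le_succ (χ' x) = χ x := by
    intro m χ hχ
    have hk : ∀ t : T, Ideal.Quotient.factorPow I (n + m).le_succ (Ideal.Quotient.mk _ t) = 0 →
        t ∈ I ^ (n + m) := by
      intro t ht
      rw [Ideal.Quotient.factor_mk] at ht
      exact Ideal.Quotient.eq_zero_iff_mem.1 ht
    refine exists_lift_of_isSeparableExt hres hsep hR hS hπ ((Ideal.Quotient.mk _).comp f)
      (Ideal.Quotient.factorPow I (n + m).le_succ) (Ideal.Quotient.factor_surjective _) ?_ ?_ χ ?_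
    · intro s t hs ht
      obtain ⟨s, rfl⟩ := Ideal.Quotient.mk_surjective s
      obtain ⟨t, rfl⟩ := Ideal.Quotient.mk_surjective t
      rw [← map_mul]
      -- Here `n ≥ 1` gives `n + m + 1 ≤ 2 * (n + m)`.
      refine Ideal.Quotient.eq_zero_iff_mem.2
        (Ideal.pow_le_pow_right (by omega) (?_ : s * t ∈ I ^ ((n + m) + (n + m))))
      rw [pow_add]
      exact Ideal.mul_mem_mul (hk _ hs) (hk _ ht)
    · intro t ht
      obtain ⟨t, rfl⟩ := Ideal.Quotient.mk_surjective t
      rw [RingHom.comp_apply, ← map_mul]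
      refine Ideal.Quotient.eq_zero_iff_mem.2 ?_
      rw [Nat.succ_eq_add_one, pow_succ']
      exact Ideal.mul_mem_mul hf (hk _ ht)
    · intro r
      rw [hχ, RingHom.comp_apply, Ideal.Quotient.factor_mk]
  choose G hG hG' using step
  let χ : ∀ m, {χ : S →+* T ⧸ I ^ (n + m) //
      ∀ r, χ (algebraMap R S r) = Ideal.Quotient.mk _ (f r)} := fun m =>
    Nat.rec ⟨ψ, hψ⟩ (fun m χ => ⟨G m χ.1 χ.2, hG m χ.1 χ.2⟩) m
  have hmono : StrictMono (fun m => n + m) := fun a b h => Nat.add_lt_add_left h n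
  have hcompat : ∀ {m}, (Ideal.Quotient.factorPow I (hmono.monotone m.le_succ)).comp
      (χ (m + 1)).1 = (χ m).1 := fun {m} => RingHom.ext fun x => hG' m (χ m).1 (χ m).2 x
  have hmk : ∀ m x, Ideal.Quotient.mk (I ^ (n + m)) (IsAdicComplete.StrictMono.liftRingHom I hmono
      (fun m => (χ m).1) hcompat x) = (χ m).1 x := fun m x =>
    IsAdicComplete.StrictMono.mk_liftRingHom I hmono (fun m => (χ m).1) hcompat x
  refine ⟨IsAdicComplete.StrictMono.liftRingHom I hmono (fun m => (χ m).1) hcompat,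
    fun r => ?_, fun x => hmk 0 x⟩
  refine IsHausdorff.eq_iff_smodEq (I := I) |>.2 fun m => ?_
  rw [SModEq.sub_mem, smul_eq_mul, Ideal.mul_top]
  refine Ideal.pow_le_pow_right (Nat.le_add_left m n) (Ideal.Quotient.eq.1 ?_)
  rw [hmk, (χ m).2]

end Lifting


/-! ### Discrete valuations, completeness and ramification index -/

section Valuations

open IsLocalRing WithZero

variable {K : Type*} [Field K] {L : Type*} [Field L]

theorem exp_neg_one_pow (n : ℕ) : (exp (-1) : ℤᵐ⁰) ^ n = exp (-(n : ℤ)) := by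
  rw [← exp_nsmul, nsmul_eq_mul, mul_neg_one]

theorem lt_one_iff_le_exp_neg_one {x : ℤᵐ⁰} : x < 1 ↔ x ≤ exp (-1) := by
  by_cases hx : x = 0
  · simp [hx]
  · rw [← exp_log hx, ← exp_zero, exp_lt_exp, exp_le_exp]
    omega

theorem mem_span_singleton_iff (v : Valuation K ℤᵐ⁰) {a : v.valuationSubring} (ha : a ≠ 0)
    (x : v.valuationSubring) : x ∈ Ideal.span {a} ↔ v (x : K) ≤ v (a : K) := by
  have ha' : (a : K) ≠ 0 := fun h => ha (Subtype.ext h)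
  rw [Ideal.mem_span_singleton]
  constructor
  · rintro ⟨z, rfl⟩
    rw [MulMemClass.coe_mul, map_mul]
    exact mul_le_of_le_one_right' z.2
  · intro h
    refine ⟨⟨x / a, ?_⟩, Subtype.ext (mul_div_cancel₀ (x : K) ha').symm⟩
    rw [Valuation.mem_valuationSubring_iff, map_div₀]
    exact div_le_one_of_le₀ h zero_le

section Uniformizer

variable {v : Valuation K ℤᵐ⁰} {π : v.valuationSubring} (hπ : v (π : K) = exp (-1))
include hπ

theorem uniformizer_ne_zero : π ≠ 0 := by
  rintro rfl
  rw [ZeroMemClass.coe_zero, map_zero] at hπ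
  exact exp_ne_zero hπ.symm

theorem maximalIdeal_eq_span : maximalIdeal v.valuationSubring = Ideal.span {π} := by
  ext x
  rw [mem_span_singleton_iff v (uniformizer_ne_zero hπ), hπ, ← lt_one_iff_le_exp_neg_one]
  exact Valuation.mem_maximalIdeal_iff _ _

theorem mem_maximalIdeal_pow_iff {n : ℕ} {x : v.valuationSubring} :
    x ∈ maximalIdeal v.valuationSubring ^ n ↔ v (x : K) ≤ exp (-(n : ℤ)) := by
  rw [maximalIdeal_eq_span hπ, Ideal.span_singleton_pow,
    mem_span_singleton_iff v (pow_ne_zero _ (uniformizer_ne_zero hπ)), SubmonoidClass.coe_pow,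
    map_pow, hπ, exp_neg_one_pow]

theorem exists_eq_zpow_mul {x : K} (hx : x ≠ 0) :
    ∃ (k : ℤ) (u : v.valuationSubring), v (u : K) = 1 ∧ x = (π : K) ^ k * u := by
  have hπ0 : (π : K) ≠ 0 := fun h => uniformizer_ne_zero hπ (Subtype.ext h)
  have hvx : v x ≠ 0 := (Valuation.ne_zero_iff v).2 hx
  have h1 : v ((π : K) ^ (log (v x)) * x) = 1 := by
    rw [map_mul, map_zpow₀, hπ, ← exp_zsmul, smul_eq_mul, mul_neg_one]
    conv_lhs => rw [← exp_log hvx, log_exp, ← exp_add, neg_add_cancel]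
    rfl
  refine ⟨-log (v x), ⟨_, h1.le⟩, h1, ?_⟩
  rw [← mul_assoc, ← zpow_add₀ hπ0, neg_add_cancel, zpow_zero, one_mul]

theorem exists_limit_of_completeSpace (hc : @CompleteSpace K (Valued.mk' v).toUniformSpace)
    (u : ℕ → K) (hu : ∀ {m n}, m ≤ n → v (u m - u n) ≤ exp (-(m : ℤ))) :
    ∃ y, ∀ m, v (u m - y) ≤ exp (-(m : ℤ)) := by
  let _ : Valued K ℤᵐ⁰ := Valued.mk' v
  have hc : CompleteSpace K := hc
  have hcau : CauchySeq u := by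
    refine Valued.cauchy_iff.2 ⟨inferInstance, fun γ => ?_⟩
    obtain ⟨N, hN⟩ := exists_exp_neg_natCast_lt
      (x := MonoidWithZeroHom.ValueGroup₀.embedding γ.1) ((map_ne_zero _).2 γ.ne_zero)
    refine ⟨u '' Set.Ici N, Filter.image_mem_map (Filter.Ici_mem_atTop N), ?_⟩
    rintro _ ⟨a, ha, rfl⟩ _ ⟨b, hb, rfl⟩
    rw [Valuation.restrict_lt_iff_lt_embedding]
    refine lt_of_le_of_lt ?_ hN
    change v (u b - u a) ≤ _
    have h := v.map_sub_le (hu hb) (hu ha)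
    rw [Valuation.map_sub_swap] at h
    simpa using h
  obtain ⟨y, hy⟩ := cauchySeq_tendsto_of_complete hcau
  refine ⟨y, fun m => ?_⟩
  -- Closed balls are topologically closed, so the estimate survives the limit.
  have hcl := Valued.isClosed_closedBall K (Valued.v.restrict ((π : K) ^ m))
  have := hcl.mem_of_tendsto (hy.const_sub (u m)) (Filter.eventually_atTop.2 ⟨m, fun n hn => ?_⟩)
  · have h : v (u m - y) ≤ v ((π : K) ^ m) := Valuation.restrict_le_iff _ |>.1 this
    rwa [map_pow, hπ, exp_neg_one_pow] at h
  · refine Valuation.restrict_le_iff _ |>.2 ?_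
    change v (u m - u n) ≤ v ((π : K) ^ m)
    rw [map_pow, hπ, exp_neg_one_pow]
    exact hu hn

theorem isAdicComplete_of_completeSpace
    (hc : @CompleteSpace K (Valued.mk' v).toUniformSpace) :
    IsAdicComplete (maximalIdeal v.valuationSubring) v.valuationSubring := by
  have key : ∀ (n : ℕ) (x y : v.valuationSubring),
      x ≡ y [SMOD (maximalIdeal v.valuationSubring ^ n • ⊤ :
        Submodule v.valuationSubring v.valuationSubring)] ↔ v ((x : K) - y) ≤ exp (-(n : ℤ)) := by
    intro n x y
    rw [SModEq.sub_mem, smul_eq_mul, Ideal.mul_top, mem_maximalIdeal_pow_iff hπ]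
    rfl
  refine { haus' := fun x hx => ?_, prec' := fun f hf => ?_ }
  · by_contra h0
    obtain ⟨N, hN⟩ := exists_exp_neg_natCast_lt (x := v (x : K))
      ((Valuation.ne_zero_iff v).2 fun h => h0 (Subtype.ext h))
    have := (key N x 0).1 (hx N)
    rw [ZeroMemClass.coe_zero, sub_zero] at this
    exact absurd this hN.not_ge
  · obtain ⟨y, hy⟩ := exists_limit_of_completeSpace hπ hc (fun n => (f n : K))
      fun h => (key _ _ _).1 (hf h)
    have hy1 : v y ≤ 1 := by
      have h := v.map_sub_le (x := (f 0 : K)) (f 0).2 (by simpa using hy 0)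
      simpa using h
    exact ⟨⟨y, hy1⟩, fun n => (key _ _ _).2 (hy n)⟩

end Uniformizer

namespace IsCompleteFinRamified

variable {v : Valuation K ℤᵐ⁰} {w : Valuation L ℤᵐ⁰} {p e : ℕ}

theorem exists_uniformizer (hv : IsCompleteFinRamified v p e) :
    ∃ π : v.valuationSubring, v (π : K) = exp (-1) := by
  obtain ⟨π, hπ⟩ := hv.surjective (exp (-1))
  refine ⟨⟨π, ?_⟩, hπ⟩
  rw [Valuation.mem_valuationSubring_iff, hπ]
  exact (lt_one_iff_le_exp_neg_one.2 le_rfl).le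

/-- The logarithm turns the interval from `v p` to `1` into an integer interval, whose cardinality
is `-log (v p)`. -/
theorem map_prime (hv : IsCompleteFinRamified v p e) : v (p : K) = exp (-(e : ℤ)) ∧ 0 < e := by
  have h1 : v (p : K) < 1 := by
    have := hv.residueChar
    have h : residue v.valuationSubring (p : v.valuationSubring) = 0 := by
      rw [map_natCast, CharP.cast_eq_zero]
    rw [residue_eq_zero_iff] at h
    exact (Valuation.mem_maximalIdeal_iff _ _).1 h
  have := hv.charZero
  have h0 : v (p : K) ≠ 0 := (Valuation.ne_zero_iff v).2 (Nat.cast_ne_zero.2 hv.prime.ne_zero)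
  have hS : Set.Ico (v (p : K)) 1 = exp '' Set.Ico (log (v (p : K))) 0 := by
    ext x
    constructor
    · rintro ⟨hx, hx1⟩
      have hx0 : x ≠ 0 := fun h => h0 (le_zero_iff.1 (h ▸ hx))
      refine ⟨log x, ⟨?_, ?_⟩, exp_log hx0⟩
      · rwa [le_log_iff_exp_le hx0, exp_log h0]
      · rwa [log_lt_iff_lt_exp hx0, exp_zero]
    · rintro ⟨k, ⟨hk, hk0⟩, rfl⟩
      refine ⟨(log_le_iff_le_exp h0).1 hk, ?_⟩
      rwa [← exp_zero, exp_lt_exp]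
  have hlog : log (v (p : K)) < 0 := by rwa [log_lt_iff_lt_exp h0, exp_zero]
  have hcard := hv.index
  rw [hS, Set.ncard_image_of_injective _ exp_injective, ← Finset.coe_Ico, Set.ncard_coe_finset,
    Int.card_Ico] at hcard
  refine ⟨?_, by omega⟩
  conv_lhs => rw [← exp_log h0]
  congr 1
  omega

/-- Embeddings between fields with the same ramification index preserve the normalized valuation. -/
theorem map_valuedEmb (hv : IsCompleteFinRamified v p e) (hw : IsCompleteFinRamified w p e)
    (Φ : ValuedEmb v w) (x : K) : w (Φ.toRingHom x) = v x := by
  obtain ⟨π, hπ⟩ := hv.exists_uniformizer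
  have h1 : w (Φ.toRingHom π) = exp (-1) := by
    -- An embedding fixes `p`, so it preserves this relation; since `w p` involves the same `e`,
    -- taking `e`-th roots gives `w (Φ π)`.
    have h : v ((π : K) ^ e) = v (p : K) := by
      rw [map_pow, hπ, exp_neg_one_pow, hv.map_prime.1]
    have h' := Φ.isEquiv.eq_iff.1 h
    simp only [Valuation.comap_apply, map_pow, map_natCast, hw.map_prime.1] at h'
    rw [← exp_neg_one_pow] at h'
    exact (pow_left_inj₀ zero_le zero_le hw.map_prime.2.ne').1 h'
  by_cases hx : x = 0
  · simp [hx]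
  · obtain ⟨k, u, hu, rfl⟩ := exists_eq_zpow_mul hπ hx
    have hu' : w (Φ.toRingHom u) = 1 := Φ.isEquiv.eq_one_iff_eq_one.1 hu
    rw [map_mul, map_mul, map_mul, hu, hu', map_zpow₀, map_zpow₀, map_zpow₀, hπ, h1]

end IsCompleteFinRamified

end Valuations


/-! ### From hyperfield embeddings to valued field embeddings -/

section Hyperfields

open IsLocalRing WithZero

variable {K : Type*} [Field K] {L : Type*} [Field L]
  {v : Valuation K ℤᵐ⁰} {w : Valuation L ℤᵐ⁰} {n : ℕ}

namespace Hyper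

theorem val_mk (a : K) : val (mk v n a) = v a := rfl

theorem exists_mk_eq (α : Hyper v n) : ∃ a, mk v n a = α := Quotient.exists_rep α

theorem mk_mul (a b : K) : mk v n (a * b) = mk v n a * mk v n b := rfl

theorem map_sub_le_of_mk_eq_mk {π : v.valuationSubring} (hπ : v (π : K) = exp (-1)) (hn : 0 < n)
    {a b : K} (ha : v a ≤ 1) (h : mk v n a = mk v n b) : v (b - a) ≤ exp (-(n : ℤ)) := by
  obtain ⟨x, hx, rfl⟩ := (mk_eq_mk_iff hn a b).1 h
  rw [mul_one_add, add_sub_cancel_left, map_mul]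
  exact (mul_le_of_le_one_left' ha).trans ((mem_maximalIdeal_pow_iff hπ).1 hx)

/-- The multiplier is `1 + (b - a) / a`; dividing by `a` costs no precision because `a` is a unit.
-/
theorem mk_eq_mk_of_map_sub_le {π : v.valuationSubring} (hπ : v (π : K) = exp (-1)) (hn : 0 < n)
    {a b : K} (ha : v a = 1) (h : v (b - a) ≤ exp (-(n : ℤ))) : mk v n a = mk v n b := by
  have ha0 : a ≠ 0 := by
    rintro rfl
    simp at ha
  have hx : v ((b - a) / a) ≤ exp (-(n : ℤ)) := by rwa [map_div₀, ha, div_one]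
  have h1 : exp (-(n : ℤ)) ≤ (1 : ℤᵐ⁰) := by
    rw [← exp_zero, exp_le_exp]
    omega
  refine (mk_eq_mk_iff hn a b).2
    ⟨⟨(b - a) / a, hx.trans h1⟩, (mem_maximalIdeal_pow_iff hπ).2 hx, ?_⟩
  rw [mul_one_add, mul_div_cancel₀ _ ha0, add_sub_cancel]

end Hyper

namespace HyperEmb

/-- Every element of the image of the valuation ring has a representative in the valuation ring. -/
theorem exists_integer_mk_eq (φ : HyperEmb v w n) (a : v.valuationSubring) :
    ∃ y : w.valuationSubring, Hyper.mk w n y = φ.toFun (Hyper.mk v n a) := by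
  obtain ⟨y, hy⟩ := Hyper.exists_mk_eq (φ.toFun (Hyper.mk v n a))
  have h1 : Hyper.val (φ.toFun (Hyper.mk v n a)) ≤ Hyper.val (φ.toFun (Hyper.mk v n 1)) := by
    rw [← φ.val_le_iff, Hyper.val_mk, Hyper.val_mk, _root_.map_one]
    exact a.2
  have h2 : φ.toFun (Hyper.mk v n 1) = Hyper.mk w n 1 := φ.map_one
  rw [h2, ← hy, Hyper.val_mk, Hyper.val_mk, _root_.map_one] at h1
  exact ⟨⟨y, h1⟩, hy⟩

/-- An embedding of `n`th valued hyperfields induces a ring homomorphism of valuation rings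
modulo `𝔪 ^ n`. -/
theorem exists_ringHom (φ : HyperEmb v w n) (hn : 0 < n) {π : w.valuationSubring}
    (hπ : w (π : L) = exp (-1)) :
    ∃ ψ : v.valuationSubring →+* w.valuationSubring ⧸ maximalIdeal w.valuationSubring ^ n,
      ∀ (a : v.valuationSubring) (y : w.valuationSubring),
        Hyper.mk w n y = φ.toFun (Hyper.mk v n a) → ψ a = Ideal.Quotient.mk _ y := by
  choose F hF using φ.exists_integer_mk_eq
  have hmk : ∀ {y z : w.valuationSubring}, Hyper.mk w n y = Hyper.mk w n z →
      Ideal.Quotient.mk (maximalIdeal w.valuationSubring ^ n) y = Ideal.Quotient.mk _ z := by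
    intro y z h
    refine Ideal.Quotient.eq.2 ((mem_maximalIdeal_pow_iff hπ).2 ?_)
    exact Hyper.map_sub_le_of_mk_eq_mk hπ hn z.2 h.symm
  have hone : φ.toFun (Hyper.mk v n 1) = Hyper.mk w n 1 := φ.map_one
  have hzero : φ.toFun (Hyper.mk v n 0) = Hyper.mk w n 0 := φ.map_zero
  refine ⟨{
    toFun := fun a => Ideal.Quotient.mk _ (F a)
    map_one' := ?_
    map_mul' := ?_
    map_zero' := ?_
    map_add' := ?_ }, fun a y hy => hmk ((hF a).trans hy.symm)⟩
  · rw [← _root_.map_one (Ideal.Quotient.mk _)]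
    exact hmk ((hF 1).trans hone)
  · intro a b
    rw [← _root_.map_mul]
    refine hmk ((hF _).trans ?_)
    rw [MulMemClass.coe_mul, MulMemClass.coe_mul, Hyper.mk_mul, Hyper.mk_mul, hF, hF]
    exact φ.map_mul _ _
  · rw [← _root_.map_zero (Ideal.Quotient.mk _)]
    exact hmk ((hF 0).trans hzero)
  · intro a b
    -- Hyperaddition only provides some representatives `x`, `y` whose sum represents the image of
    -- `a + b`; modulo `𝔪 ^ n` they agree with `F a` and `F b`.
    obtain ⟨x, y, hx, hy, hxy⟩ := φ.map_hadd _ _ ⟨Hyper.mk v n (a + b), ⟨a, b, rfl, rfl, rfl⟩, rfl⟩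
    have hint : ∀ {x : L} {a : v.valuationSubring}, Hyper.mk w n x = φ.toFun (Hyper.mk v n a) →
        w x ≤ 1 := by
      intro x a h
      have h' : w x = w (F a) := congrArg Hyper.val (h.trans (hF a).symm)
      exact h'.le.trans (F a).2
    lift x to w.valuationSubring using hint hx
    lift y to w.valuationSubring using hint hy
    rw [hmk ((hF a).trans hx.symm), hmk ((hF b).trans hy.symm), ← map_add]
    exact hmk ((hF (a + b)).trans hxy.symm)

end HyperEmb

/-- If a ring homomorphism `Ψ` of valuation rings maps the uniformizer `π` to a uniformizer, then
it extends to an embedding of valued fields. -/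
theorem exists_valuedEmb_of_integer_ringHom (Ψ : v.valuationSubring →+* w.valuationSubring)
    {π : v.valuationSubring} (hπ : v (π : K) = exp (-1)) (hΨ : w (Ψ π : L) = exp (-1)) :
    ∃ Φ : ValuedEmb v w, ∀ x : v.valuationSubring, Φ.toRingHom (x : K) = Ψ x := by
  have hinj : Function.Injective (algebraMap w.valuationSubring L |>.comp Ψ) := by
    rw [injective_iff_map_eq_zero]
    intro a ha
    by_contra ha0
    obtain ⟨N, hN⟩ := exists_exp_neg_natCast_lt (x := v (a : K))
      ((Valuation.ne_zero_iff v).2 fun h => ha0 (Subtype.ext h))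
    -- A nonzero `a` divides a power of `π`, so `Ψ a = 0` would force `Ψ π = 0`.
    have hmem : π ^ N ∈ Ideal.span {a} := by
      rw [mem_span_singleton_iff v ha0, SubmonoidClass.coe_pow, map_pow, hπ, exp_neg_one_pow]
      exact hN.le
    have h := map_dvd (algebraMap w.valuationSubring L |>.comp Ψ) (Ideal.mem_span_singleton.1 hmem)
    rw [ha, zero_dvd_iff, map_pow] at h
    have h0 : (Ψ π : L) = 0 := eq_zero_of_pow_eq_zero h
    rw [h0, map_zero] at hΨ
    exact exp_ne_zero hΨ.symm
  let Φ : K →+* L := IsFractionRing.lift hinj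
  have hΦ : ∀ x : v.valuationSubring, Φ (x : K) = Ψ x := fun x =>
    IsFractionRing.lift_algebraMap hinj x
  have hval : ∀ x, w (Φ x) = v x := by
    intro x
    by_cases hx : x = 0
    · simp [hx]
    · obtain ⟨k, u, hu, rfl⟩ := exists_eq_zpow_mul hπ hx
      have hunit : IsUnit u := (Valuation.integer.integers v).isUnit_iff_valuation_eq_one.2 hu
      have hu' : w (Ψ u : L) = 1 :=
        (Valuation.integer.integers w).isUnit_iff_valuation_eq_one.1 (hunit.map Ψ)
      rw [map_mul, map_mul, map_mul, map_zpow₀, map_zpow₀, map_zpow₀, hΦ, hΦ, hu', hΨ, hu, hπ]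
  refine ⟨⟨Φ, fun x y => ?_⟩, hΦ⟩
  rw [Valuation.comap_apply, Valuation.comap_apply, hval, hval]

/-- An embedding of `n`th valued hyperfields over a valued subfield with the same ramification
index and separable residue field extension is induced by an embedding of valued fields. -/
theorem exists_valuedEmb_induced_eq {K₀ : Type*} [Field K₀] {v₀ : Valuation K₀ ℤᵐ⁰} {p e : ℕ}
    (hK₀ : IsCompleteFinRamified v₀ p e) (hK : IsCompleteFinRamified v p e)
    (hL : IsCompleteFinRamified w p e) [Algebra K₀ K] [v₀.HasExtension v]
    (hsep : IsSeparableExt p (ResidueField v₀.valuationSubring) (ResidueField v.valuationSubring))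
    (hn : 0 < n) (Φ₀ : ValuedEmb v₀ w) (φ : HyperEmb v w n)
    (hφ : ∀ α : Hyper v₀ n,
      φ.toFun (Hyper.induced n (inclusion v₀ v) α) = Hyper.induced n Φ₀ α) :
    ∃ Φ : ValuedEmb v w, (∀ x : K₀, Φ.toRingHom (algebraMap K₀ K x) = Φ₀.toRingHom x) ∧
      ∀ α : Hyper v n, φ.toFun α = Hyper.induced n Φ α := by
  have : Fact p.Prime := ⟨hK.prime⟩
  have := hK₀.residueChar
  obtain ⟨π, hπ⟩ := hK₀.exists_uniformizer
  have hφ' : ∀ x : K₀, φ.toFun (Hyper.mk v n (algebraMap K₀ K x)) =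
      Hyper.mk w n (Φ₀.toRingHom x) := fun x => hφ (Hyper.mk v₀ n x)
  have hπK : v ((algebraMap v₀.valuationSubring v.valuationSubring π : v.valuationSubring) : K) =
      exp (-1) := (hK₀.map_valuedEmb hK (inclusion v₀ v) π).trans hπ
  have hπL : w (Φ₀.integerMap π : L) = exp (-1) := (hK₀.map_valuedEmb hL Φ₀ π).trans hπ
  have := isAdicComplete_of_completeSpace hπL hL.complete
  obtain ⟨ψ, hψ⟩ := φ.exists_ringHom hn hπL
  obtain ⟨Ψ, hΨ, hΨψ⟩ := exists_adic_lift_of_isSeparableExt (fun _ => rfl) hsep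
    (maximalIdeal_eq_span hπ) (maximalIdeal_eq_span hπK)
    (fun z hz => (mul_eq_zero.1 hz).resolve_left (uniformizer_ne_zero hπK))
    (maximalIdeal w.valuationSubring) Φ₀.integerMap
    ((Valuation.mem_maximalIdeal_iff _ _).2 (lt_one_iff_le_exp_neg_one.2 hπL.le)) hn ψ
    (fun r => hψ _ _ (hφ' r).symm)
  obtain ⟨Φ, hΦ⟩ := exists_valuedEmb_of_integer_ringHom Ψ hπK (by rw [hΨ, hπL])
  have hext₀ : ∀ x : v₀.valuationSubring,
      Φ.toRingHom (algebraMap K₀ K x) = Φ₀.toRingHom x := fun x =>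
    (hΦ _).trans (congrArg Subtype.val (hΨ x))
  have hext : ∀ x : K₀, Φ.toRingHom (algebraMap K₀ K x) = Φ₀.toRingHom x := by
    intro x
    obtain ⟨a, b, -, rfl⟩ := IsFractionRing.div_surjective (A := v₀.valuationSubring) x
    rw [map_div₀, map_div₀, map_div₀]
    exact congrArg₂ _ (hext₀ a) (hext₀ b)
  refine ⟨Φ, hext, fun α => ?_⟩
  obtain ⟨x, rfl⟩ := Hyper.exists_mk_eq α
  change φ.toFun (Hyper.mk v n x) = Hyper.mk w n (Φ.toRingHom x)
  by_cases hx : x = 0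
  · rw [hx, map_zero]
    exact φ.map_zero
  -- As `π` comes from `K₀`, the factor `π ^ k` is settled by `hφ`; only the unit `u` needs the
  -- congruence modulo `𝔪 ^ n`.
  · obtain ⟨k, u, hu, rfl⟩ := exists_eq_zpow_mul hπK hx
    have hu' : φ.toFun (Hyper.mk v n u) = Hyper.mk w n (Φ.toRingHom u) := by
      obtain ⟨y, hy⟩ := φ.exists_integer_mk_eq u
      rw [← hy]
      have hΦu : w (Φ.toRingHom u) = 1 := (hK.map_valuedEmb hL Φ u).trans hu
      refine (Hyper.mk_eq_mk_of_map_sub_le hπL hn hΦu ?_).symm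
      rw [hΦ, Valuation.map_sub_swap]
      exact (mem_maximalIdeal_pow_iff hπL).1 (Ideal.Quotient.eq.1 ((hΨψ u).trans (hψ u y hy)))
    have hpow : φ.toFun (Hyper.mk v n (algebraMap K₀ K ((π : K₀) ^ k))) =
        Hyper.mk w n (Φ.toRingHom (algebraMap K₀ K ((π : K₀) ^ k))) := by
      rw [hφ', hext]
    have hcoe : ((algebraMap v₀.valuationSubring v.valuationSubring π : v.valuationSubring) : K) ^ k
        = algebraMap K₀ K ((π : K₀) ^ k) := (map_zpow₀ (algebraMap K₀ K) (π : K₀) k).symm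
    rw [hcoe, map_mul, Hyper.mk_mul, Hyper.mk_mul, φ.map_mul, hu', hpow]

end Hyperfields

end FinRam

theorem mainTheorem5
    {K₀ : Type*} {K : Type*} {L : Type*} [Field K₀] [Field K] [Field L]
    (v₀ : Valuation K₀ ℤᵐ⁰) (v : Valuation K ℤᵐ⁰) (w : Valuation L ℤᵐ⁰)
    (p e : ℕ)
    (hK₀ : FinRam.IsCompleteFinRamified v₀ p e)
    (hK : FinRam.IsCompleteFinRamified v p e)
    (hL : FinRam.IsCompleteFinRamified w p e)
    [Algebra K₀ K] [v₀.HasExtension v]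
    (hsep : FinRam.IsSeparableExt p (IsLocalRing.ResidueField v₀.valuationSubring)
      (IsLocalRing.ResidueField v.valuationSubring))
    (n : ℕ) (hn : 0 < n)
    (hwild : p ∣ e → ∃ (R : Subring K) (M : ℝ), FinRam.IsStrictCohenSubring v p R ∧
      FinRam.IsMInvariant v p R M ∧ (e : ℝ) ^ 2 * M < n)
    (Φ₀ : FinRam.ValuedEmb v₀ w)
    (φ : FinRam.HyperEmb v w n)
    (hφ : ∀ α : FinRam.Hyper v₀ n,
      φ.toFun (FinRam.Hyper.induced n (FinRam.inclusion v₀ v) α) =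
        FinRam.Hyper.induced n Φ₀ α) :
    (∃ Φ : FinRam.ValuedEmb v w,
      ∀ x : K₀, Φ.toRingHom (algebraMap K₀ K x) = Φ₀.toRingHom x) ∧
    (¬ p ∣ e → ∃ Φ : FinRam.ValuedEmb v w,
      (∀ x : K₀, Φ.toRingHom (algebraMap K₀ K x) = Φ₀.toRingHom x) ∧
      ∀ α : FinRam.Hyper v n, φ.toFun α = FinRam.Hyper.induced n Φ α) := by
  obtain ⟨Φ, hΦ, hΦφ⟩ := FinRam.exists_valuedEmb_induced_eq hK₀ hK hL hsep hn Φ₀ φ hφ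
  exact ⟨⟨Φ, hΦ⟩, fun _ => ⟨Φ, hΦ, hΦφ⟩⟩
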